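/- Let $\mathcal A$ be the set of all infinite sequences $\mathbf i=(i_1,i_2,\dots)$ of integers with $1\le i_1<i_2<\cdots$. For $\mathbf i\in\mathcal A$ and $r\ge 1$ put $$J_r(\mathbf i)=\int_{[0,1]^{i_r}}\frac{dx_1\cdots dx_{i_r}}{1-x_1\cdots x_{i_1}+x_1\cdots x_{i_2}-\cdots+(-1)^r x_1\cdots x_{i_r}}.$$ Let $\mathcal Z^\star$ be the set of multiple zeta-star values, that is, of all real numbers $$\zeta^\star(k_1,\dots,k_d)=\sum_{n_1\ge\cdots\ge n_d\ge 1}\frac{1}{n_1^{k_1}\cdots n_d^{k_d}}$$ with integers $d\ge 1$, $k_1\ge 2$ and $k_2,\dots,k_d\ge 1$. (i) For every $\mathbf i\in\mathcal A$, the integrand of $J_r(\mathbf i)$ is Lebesgue integrable on $[0,1]^{i_r}$ for all $r\ge 2$, the limit $\xi(\mathbf i)=\lim_{r\to\infty}J_r(\mathbf i)$ exists in $\mathbb R$, and $\xi(\mathbf i)>1$. (ii) The map $\xi:\mathcal A\to(1,\infty)$ is injective, and its image is $\xi(\mathcal A)=(1,\infty)\setminus\mathcal Z^\star$. -/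

import Mathlib

open MeasureTheory Filter Topology

/-- The set `𝒜` of strictly increasing sequences of positive integers
`i 0 < i 1 < i 2 < ⋯`; the entry `i s` is the mathematical `i_{s+1}`. -/
def alternatingSequences : Set (ℕ → ℕ) :=
  {i | 1 ≤ i 0 ∧ StrictMono i}

/-- The denominator `1 - x₁⋯x_{i_1} + x₁⋯x_{i_2} - ⋯ + (-1)^{r+1} x₁⋯x_{i_{r+1}}`, having `r + 1`
alternating terms after the initial `1`, in the `i_{r+1}` variables `x₁, …, x_{i_{r+1}}`. -/
def altDenom (i : ℕ → ℕ) (r : ℕ) (x : Fin (i r) → ℝ) : ℝ :=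
  1 + ∑ s ∈ Finset.range (r + 1),
    (-1) ^ (s + 1) * ∏ j ∈ Finset.univ.filter (fun j : Fin (i r) => (j : ℕ) < i s), x j

/-- The integral of the reciprocal of `altDenom i r` over the unit cube with respect to
Lebesgue measure. -/
noncomputable def altIntegral (i : ℕ → ℕ) (r : ℕ) : ℝ :=
  ∫ x in Set.Icc (0 : Fin (i r) → ℝ) 1, 1 / altDenom i r x

/-- The map `ξ`: the limit of the alternating integrals as `r → ∞`. -/
noncomputable def xi (i : ℕ → ℕ) : ℝ :=
  limUnder atTop (altIntegral i)

/-- The series `ζ⋆(k_1, …, k_d) = ∑_{n_1 ≥ ⋯ ≥ n_d ≥ 1} 1 / (n_1 ^ k_1 ⋯ n_d ^ k_d)`. -/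
noncomputable def zetaStar {d : ℕ} (k : Fin d → ℕ) : ℝ :=
  ∑' n : {n : Fin d → ℕ // Antitone n ∧ ∀ j, 1 ≤ n j}, ∏ j, 1 / ((n.1 j : ℝ) ^ k j)

/-- The set `𝒵⋆` of multiple zeta-star values `ζ⋆(k_1, …, k_d)` with `d ≥ 1`, `k_1 ≥ 2` and
`k_2, …, k_d ≥ 1` (the depth is `d + 1` in the code). For these indices the series converges. -/
def zetaStarValues : Set ℝ :=
  {z | ∃ (d : ℕ) (k : Fin (d + 1) → ℕ), 2 ≤ k 0 ∧ (∀ j, 1 ≤ k j) ∧ zetaStar k = z}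

/-! Encode `i` as a binary word whose runs, beginning with `true`, end at the entries of `i`. Let
`true` act on [0,1] by s ↦ xs and `false` by s ↦ 1 - x(1 - s). The alternating denominator is then 1
- s, where s is the composite of these maps applied to 0 or 1 (`altDenom_eq`). Averaging a power
series over x acts on its coefficients by `divStep` or `tailStep` respectively. So the integrals
start from 1/(1 - s), whose coefficients are all 1, and equal either the zeroth coefficient or the
total sum of the resulting sequence (`altIntegral_eq`).

Each finite word thus carries an interval from the zeroth coefficient to the total sum, starting
from (1, ∞). A letter splits the interval of `a` at `tailStep a 0`: `true` keeps the lower part,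
`false` the upper. Finite nonempty words beginning with `true` have exactly the multiple zeta-star
values as split points (`mem_zetaStarValues_iff`).

The length is `tailSum`: `divStep` at least halves it and `tailStep` does not increase it. Hence a
word with infinitely many letters of both kinds determines one point, interior to all its intervals.
Conversely, a point above 1 that is never a split point has a greedy word. That word cannot end in
`false` forever, since the lower endpoints would then pass the point, nor in `true` forever, since
the intervals would shrink to a fixed lower endpoint. -/

open scoped ENNReal

/-! ### The two operators on coefficient sequences -/

/-- Divide the `n`-th coefficient by `n + 1`. -/
noncomputable def divStep (a : ℕ → ℝ≥0∞) : ℕ → ℝ≥0∞ := fun n => a n / (n + 1)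

/-- Tail sums of the sequence `a m / (m + 1)`. -/
noncomputable def tailStep (a : ℕ → ℝ≥0∞) : ℕ → ℝ≥0∞ :=
  fun n => ∑' m, if n ≤ m then a m / (m + 1) else 0

/-- The operator attached to a letter. -/
noncomputable def letterStep (b : Bool) (a : ℕ → ℝ≥0∞) : ℕ → ℝ≥0∞ :=
  if b then divStep a else tailStep a

/-- The sequence obtained from `a` by applying the first `n` letters of `ω`. -/
noncomputable def wordSeq (a : ℕ → ℝ≥0∞) (ω : ℕ → Bool) : ℕ → ℕ → ℝ≥0∞
  | 0 => a
  | n + 1 => letterStep (ω n) (wordSeq a ω n)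

/-- The sum of a coefficient sequence without its first term. -/
noncomputable def tailSum (a : ℕ → ℝ≥0∞) : ℝ≥0∞ := ∑' n, a (n + 1)

lemma wordSeq_succ' (a : ℕ → ℝ≥0∞) (ω : ℕ → Bool) (n : ℕ) :
    wordSeq a ω (n + 1) = wordSeq (letterStep (ω 0) a) (fun j => ω (j + 1)) n := by
  induction n with
  | zero => rfl
  | succ n ih => rw [wordSeq, ih, wordSeq]

lemma wordSeq_congr (a : ℕ → ℝ≥0∞) {ω η : ℕ → Bool} {n : ℕ} (h : ∀ j < n, ω j = η j) :
    wordSeq a ω n = wordSeq a η n := by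
  induction n with
  | zero => rfl
  | succ n ih => rw [wordSeq, wordSeq, h n n.lt_succ_self, ih fun j hj => h j (hj.trans n.lt_succ_self)]

lemma divStep_zero (a : ℕ → ℝ≥0∞) : divStep a 0 = a 0 := by simp [divStep]

lemma tsum_divStep (a : ℕ → ℝ≥0∞) : ∑' n, divStep a n = tailStep a 0 := by
  simp [divStep, tailStep]

/-- Tonelli. The weight 1 gives conservation of the total sum, and the weights s ^ n give the action
on power series. -/
lemma tsum_tailStep_mul (a c : ℕ → ℝ≥0∞) :
    ∑' n, tailStep a n * c n = ∑' m, a m / (m + 1) * ∑ n ∈ Finset.range (m + 1), c n := by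
  simp_rw [tailStep, ← ENNReal.tsum_mul_right]
  rw [ENNReal.tsum_comm]
  refine tsum_congr fun m => ?_
  rw [tsum_eq_sum (s := Finset.range (m + 1)), Finset.mul_sum]
  · refine Finset.sum_congr rfl fun n hn => ?_
    rw [if_pos (by simpa [Nat.lt_succ_iff] using hn)]
  · intro n hn
    rw [if_neg (by simpa [Nat.lt_succ_iff] using hn), zero_mul]

lemma tsum_tailStep (a : ℕ → ℝ≥0∞) : ∑' n, tailStep a n = ∑' n, a n := by
  have h := tsum_tailStep_mul a 1
  simp only [Pi.one_apply, mul_one, Finset.sum_const, Finset.card_range, nsmul_eq_mul] at h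
  rw [h]
  refine tsum_congr fun m => ?_
  push_cast
  exact ENNReal.div_mul_cancel (by simp) (by finiteness)

lemma tsum_eq_zero_add_tailSum (a : ℕ → ℝ≥0∞) : ∑' n, a n = a 0 + tailSum a := by
  rw [tailSum, tsum_eq_zero_add' ENNReal.summable]

lemma tailSum_divStep_le (a : ℕ → ℝ≥0∞) : tailSum (divStep a) ≤ tailSum a / 2 := by
  simp only [tailSum, div_eq_mul_inv, divStep, ← ENNReal.tsum_mul_right]
  gcongr with n
  push_cast
  rw [add_assoc, one_add_one_eq_two]
  exact le_add_self

lemma tailSum_le_tsum (a : ℕ → ℝ≥0∞) : tailSum a ≤ ∑' n, a n := by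
  rw [tsum_eq_zero_add_tailSum]
  exact le_add_self

lemma tailStep_mono {a b : ℕ → ℝ≥0∞} (h : a ≤ b) : tailStep a ≤ tailStep b := by
  intro n
  unfold tailStep
  gcongr with m
  split_ifs
  · gcongr
    exact h m
  · rfl

lemma le_tailStep_zero (a : ℕ → ℝ≥0∞) : a 0 ≤ tailStep a 0 := by
  rw [← tsum_divStep, ← divStep_zero a]
  exact ENNReal.le_tsum 0

/-- The total is conserved while the zeroth term does not decrease; finiteness of `a 0` permits
cancellation. -/
lemma tailSum_tailStep_le {a : ℕ → ℝ≥0∞} (h : a 0 ≠ ∞) : tailSum (tailStep a) ≤ tailSum a := by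
  have h1 := tsum_tailStep a
  rw [tsum_eq_zero_add_tailSum, tsum_eq_zero_add_tailSum a] at h1
  have h2 : a 0 + tailSum (tailStep a) ≤ a 0 + tailSum a := by
    rw [← h1]
    gcongr
    exact le_tailStep_zero a
  exact (ENNReal.add_le_add_iff_left h).1 h2

/-! ### Regular sequences -/

/-- Positive sequences that are `O(1 / n)`. -/
def IsReg (a : ℕ → ℝ≥0∞) : Prop :=
  (∀ n, a n ≠ 0) ∧ ∃ C : ℝ≥0∞, C ≠ ∞ ∧ ∀ n : ℕ, a n ≤ C / (n + 1)

/-- The remainder 2/(N + 1) makes the bound inductive, as 1/(N + 1)² ≤ 2/(N + 1) - 2/(N + 2). The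
maximum freezes it until the sum becomes nonempty. -/
lemma sum_range_tail_inv_sq_le (n N : ℕ) :
    ∑ m ∈ Finset.range N, (if n ≤ m then (1 : ℝ) / (m + 1) / (m + 1) else 0)
      + 2 / ((max N n : ℕ) + 1 : ℝ) ≤ 2 / (n + 1) := by
  induction N with
  | zero => simp
  | succ N ih =>
    rw [Finset.sum_range_succ]
    by_cases h : n ≤ N
    · rw [max_eq_left h] at ih
      rw [if_pos h, max_eq_left (by omega)]
      have : (1 : ℝ) / (N + 1) / (N + 1) + 2 / ((N + 1 : ℕ) + 1) ≤ 2 / (N + 1) := by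
        have hN : (0 : ℝ) ≤ N := N.cast_nonneg
        push_cast
        rw [div_div, div_add_div _ _ (by positivity) (by positivity),
          div_le_div_iff₀ (by positivity) (by positivity)]
        nlinarith [mul_nonneg hN hN, mul_nonneg (mul_nonneg hN hN) hN]
      linarith
    · rw [if_neg h, add_zero, max_eq_right (by omega)]
      rwa [max_eq_right (by omega)] at ih

lemma tsum_tail_inv_sq_le (n : ℕ) :
    ∑' m : ℕ, (if n ≤ m then (1 : ℝ≥0∞) / (m + 1) / (m + 1) else 0) ≤ 2 / (n + 1) := by
  have hterm : ∀ m : ℕ, (if n ≤ m then (1 : ℝ≥0∞) / (m + 1) / (m + 1) else 0) =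
      ENNReal.ofReal (if n ≤ m then (1 : ℝ) / (m + 1) / (m + 1) else 0) := by
    intro m
    split_ifs
    · have h : ENNReal.ofReal ((m : ℝ) + 1) = m + 1 := by
        rw [ENNReal.ofReal_add (by positivity) (by positivity)]; simp
      rw [ENNReal.ofReal_div_of_pos (by positivity), ENNReal.ofReal_div_of_pos (by positivity), h,
        ENNReal.ofReal_one]
    · simp
  have hright : (2 : ℝ≥0∞) / (n + 1) = ENNReal.ofReal (2 / (n + 1)) := by
    rw [ENNReal.ofReal_div_of_pos (by positivity), ENNReal.ofReal_add (by positivity) (by positivity)]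
    simp
  rw [hright, ENNReal.tsum_eq_iSup_nat]
  refine iSup_le fun N => ?_
  simp_rw [hterm]
  rw [← ENNReal.ofReal_sum_of_nonneg fun m _ => by split_ifs <;> positivity]
  refine ENNReal.ofReal_le_ofReal ?_
  have := sum_range_tail_inv_sq_le n N
  have h2 : (0 : ℝ) ≤ 2 / ((max N n : ℕ) + 1 : ℝ) := by positivity
  linarith

lemma tailStep_le {a : ℕ → ℝ≥0∞} {C : ℝ≥0∞} (h : ∀ n : ℕ, a n ≤ C / (n + 1)) (n : ℕ) :
    tailStep a n ≤ C * 2 / (n + 1) := by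
  calc tailStep a n
      ≤ ∑' m : ℕ, C * (if n ≤ m then (1 : ℝ≥0∞) / (m + 1) / (m + 1) else 0) := by
        unfold tailStep
        gcongr with m
        split_ifs
        · rw [← mul_div_assoc, ← mul_div_assoc, mul_one]
          gcongr
          exact h m
        · simp
    _ ≤ C * (2 / (n + 1)) := by
        rw [ENNReal.tsum_mul_left]
        gcongr
        exact tsum_tail_inv_sq_le n
    _ = C * 2 / (n + 1) := (mul_div_assoc _ _ _).symm

lemma IsReg.divStep {a : ℕ → ℝ≥0∞} (h : IsReg a) : IsReg (divStep a) := by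
  obtain ⟨h0, C, hC, hle⟩ := h
  refine ⟨fun n => ENNReal.div_ne_zero.2 ⟨h0 n, by finiteness⟩, C, hC, fun n => ?_⟩
  refine le_trans ?_ (hle n)
  refine ENNReal.div_le_of_le_mul ?_
  exact le_mul_of_one_le_right (zero_le) le_add_self

lemma IsReg.tailStep {a : ℕ → ℝ≥0∞} (h : IsReg a) : IsReg (tailStep a) := by
  obtain ⟨h0, C, hC, hle⟩ := h
  refine ⟨fun n hn => ?_, C * 2, by finiteness, tailStep_le hle⟩
  have h1 := ENNReal.tsum_eq_zero.1 hn n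
  rw [if_pos le_rfl] at h1
  exact ENNReal.div_ne_zero.2 ⟨h0 n, by finiteness⟩ h1

lemma isReg_divStep_one : IsReg (_root_.divStep 1) :=
  ⟨fun n => ENNReal.div_ne_zero.2 ⟨one_ne_zero, by finiteness⟩, 1, ENNReal.one_ne_top,
    fun n => le_rfl⟩

lemma IsReg.letterStep {a : ℕ → ℝ≥0∞} (h : IsReg a) (b : Bool) : IsReg (letterStep b a) := by
  cases b
  · exact h.tailStep
  · exact h.divStep

lemma IsReg.ne_top {a : ℕ → ℝ≥0∞} (h : IsReg a) (n : ℕ) : a n ≠ ∞ := by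
  obtain ⟨h0, C, hC, hle⟩ := h
  exact ((hle n).trans_lt (ENNReal.div_lt_top hC (by simp))).ne

lemma IsReg.tsum_divStep_ne_top {a : ℕ → ℝ≥0∞} (h : IsReg a) : ∑' n, _root_.divStep a n ≠ ∞ := by
  rw [tsum_divStep]
  exact h.tailStep.ne_top 0

lemma IsReg.lt_tailStep_zero {a : ℕ → ℝ≥0∞} (h : IsReg a) : a 0 < _root_.tailStep a 0 := by
  rw [← tsum_divStep, tsum_eq_zero_add_tailSum, divStep_zero]
  refine ENNReal.lt_add_right (h.ne_top 0) fun h0 => ?_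
  exact h.divStep.1 1 (ENNReal.tsum_eq_zero.1 h0 0)

lemma IsReg.tailStep_zero_lt {a : ℕ → ℝ≥0∞} (h : IsReg a) : _root_.tailStep a 0 < ∑' n, a n := by
  rw [← tsum_tailStep, tsum_eq_zero_add_tailSum]
  refine ENNReal.lt_add_right (h.tailStep.ne_top 0) fun h0 => ?_
  exact h.tailStep.1 1 (ENNReal.tsum_eq_zero.1 h0 0)

/-- The constant sequence 1 is not O(1/n), so regularity begins only after the first letter, which
must be `true`. -/
lemma isReg_wordSeq {ω : ℕ → Bool} (h0 : ω 0 = true) (n : ℕ) : IsReg (wordSeq 1 ω (n + 1)) := by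
  induction n with
  | zero => simpa [wordSeq, h0, _root_.letterStep] using isReg_divStep_one
  | succ n ih => exact ih.letterStep _

/-! ### Iterating `tailStep` exhausts the total sum -/

/-- Truncation of a sequence. -/
noncomputable def truncSeq (N : ℕ) (a : ℕ → ℝ≥0∞) : ℕ → ℝ≥0∞ := fun n => if n < N then a n else 0

lemma truncSeq_le (N : ℕ) (a : ℕ → ℝ≥0∞) : truncSeq N a ≤ a := by
  intro n
  unfold truncSeq
  split_ifs
  · rfl
  · exact zero_le

lemma tailStep_eq_zero {a : ℕ → ℝ≥0∞} {N : ℕ} (h : ∀ n, N ≤ n → a n = 0) (n : ℕ) (hn : N ≤ n) :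
    tailStep a n = 0 := by
  refine ENNReal.tsum_eq_zero.2 fun m => ?_
  split_ifs with hm
  · rw [h m (hn.trans hm), ENNReal.zero_div]
  · rfl

lemma tailSum_tailStep (a : ℕ → ℝ≥0∞) :
    tailSum (tailStep a) = ∑' m : ℕ, a m / (m + 1) * m := by
  have h := tsum_tailStep_mul a (fun n => if n = 0 then 0 else 1)
  rw [tsum_eq_zero_add' ENNReal.summable] at h
  simp only [if_true, mul_zero, zero_add, Nat.add_eq_zero_iff, one_ne_zero, and_false, if_false,
    mul_one] at h
  rw [tailSum, h]
  refine tsum_congr fun m => ?_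
  rw [Finset.sum_range_succ']
  simp

/-- On sequences supported below `N + 1`, `tailStep` contracts the tail sum. -/
lemma tailSum_tailStep_le_of_support {a : ℕ → ℝ≥0∞} {N : ℕ} (h : ∀ n, N + 1 ≤ n → a n = 0) :
    tailSum (tailStep a) ≤ N / (N + 1) * tailSum a := by
  rw [tailSum_tailStep, tsum_eq_zero_add' ENNReal.summable, tailSum, ← ENNReal.tsum_mul_left]
  simp only [Nat.cast_zero, mul_zero, zero_add]
  refine ENNReal.tsum_le_tsum fun m => ?_
  by_cases hm : N + 1 ≤ m + 1
  · simp [h _ hm]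
  · have h1 : ((m + 1 : ℕ) : ℝ≥0∞) / ((m + 1 : ℕ) + 1) ≤ N / (N + 1) := by
      rw [ENNReal.div_le_iff (by simp) (by finiteness), mul_comm, ← mul_div_assoc,
        ENNReal.le_div_iff_mul_le (by simp) (Or.inl (by finiteness))]
      norm_cast
      nlinarith
    calc a (m + 1) / ((m + 1 : ℕ) + 1) * (m + 1 : ℕ)
        = ((m + 1 : ℕ) : ℝ≥0∞) / ((m + 1 : ℕ) + 1) * a (m + 1) := by
          simp only [div_eq_mul_inv]; ring
      _ ≤ _ := by gcongr

/-- Truncate so that the finite total still exceeds `v`. Iteration conserves this total but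
contracts the part off index 0 geometrically, so the mass collects at index 0. -/
lemma exists_lt_iterate_tailStep {a : ℕ → ℝ≥0∞} (ha : ∀ n, a n ≠ ∞) {v : ℝ≥0∞}
    (hv : v < ∑' n, a n) : ∃ k, v < (tailStep^[k] a) 0 := by
  rw [ENNReal.tsum_eq_iSup_nat] at hv
  obtain ⟨N, hN⟩ := lt_iSup_iff.1 hv
  set b := truncSeq (N + 1) a with hb
  have hsupp : ∀ k n, N + 1 ≤ n → (tailStep^[k] b) n = 0 := by
    intro k
    induction k with
    | zero => intro n hn; simp [hb, truncSeq, not_lt.2 hn]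
    | succ k ih => rw [Function.iterate_succ_apply']; exact tailStep_eq_zero ih
  have hle : ∀ k, tailStep^[k] b ≤ tailStep^[k] a := by
    intro k
    induction k with
    | zero => exact truncSeq_le _ _
    | succ k ih =>
      rw [Function.iterate_succ_apply', Function.iterate_succ_apply']; exact tailStep_mono ih
  have hsum : ∀ k, ∑' n, (tailStep^[k] b) n = ∑' n, b n := by
    intro k
    induction k with
    | zero => rfl
    | succ k ih => rw [Function.iterate_succ_apply', tsum_tailStep, ih]
  have hbsum : ∑' n, b n = ∑ n ∈ Finset.range (N + 1), a n := by
    rw [tsum_eq_sum (s := Finset.range (N + 1))]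
    · refine Finset.sum_congr rfl fun n hn => ?_
      simp [hb, truncSeq, Finset.mem_range.1 hn]
    · intro n hn
      simp [hb, truncSeq, show ¬ n < N + 1 by simpa using hn]
  have hfin : ∑' n, b n ≠ ∞ := by
    rw [hbsum]
    exact ENNReal.sum_ne_top.2 fun n _ => ha n
  have htail : ∀ k, tailSum (tailStep^[k] b) ≤ (N / (N + 1)) ^ k * tailSum b := by
    intro k
    induction k with
    | zero => simp
    | succ k ih =>
      rw [Function.iterate_succ_apply', pow_succ', mul_assoc]
      exact (tailSum_tailStep_le_of_support (hsupp k)).trans (by gcongr)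
  have hvb : v < ∑' n, b n := by
    rw [hbsum]
    exact hN.trans_le (Finset.sum_le_sum_of_subset (by simp))
  have hq : (N : ℝ≥0∞) / (N + 1) < 1 := by
    rw [ENNReal.div_lt_iff (by simp) (by simp), one_mul]
    exact ENNReal.lt_add_right (by simp) one_ne_zero
  have hlim : Tendsto (fun k => ((N : ℝ≥0∞) / (N + 1)) ^ k * tailSum b) atTop (𝓝 0) := by
    have h := ENNReal.Tendsto.mul_const (b := tailSum b) (ENNReal.tendsto_pow_atTop_nhds_zero_of_lt_one hq)
      (Or.inr ((tailSum_le_tsum b).trans_lt hfin.lt_top).ne)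
    rwa [zero_mul] at h
  obtain ⟨k, hk⟩ := (hlim.eventually_lt_const (tsub_pos_of_lt hvb)).exists
  refine ⟨k, lt_of_lt_of_le ?_ (hle k 0)⟩
  by_contra hcon
  have h1 := hsum k
  rw [tsum_eq_zero_add_tailSum] at h1
  have h2 : tailSum (tailStep^[k] b) < ∑' n, b n - v := (htail k).trans_lt hk
  have h3 : (tailStep^[k] b) 0 + tailSum (tailStep^[k] b) < v + (∑' n, b n - v) :=
    ENNReal.add_lt_add_of_le_of_lt
      (((not_lt.1 hcon).trans_lt hvb).trans hfin.lt_top).ne (not_lt.1 hcon) h2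
  rw [h1, add_tsub_cancel_of_le hvb.le] at h3
  exact lt_irrefl _ h3

/-! ### Power series with coefficients in `ℝ≥0∞` and their averages -/

/-- The sum of the power series with coefficients `a`. -/
noncomputable def evalSeries (a : ℕ → ℝ≥0∞) (s : ℝ) : ℝ≥0∞ := ∑' n, a n * ENNReal.ofReal (s ^ n)

/-- The uniform measure on the unit cube. -/
noncomputable def cubeMeasure (N : ℕ) : Measure (Fin N → ℝ) :=
  Measure.pi fun _ => volume.restrict (Set.Icc (0 : ℝ) 1)

instance (N : ℕ) : SFinite (cubeMeasure N) := by
  unfold cubeMeasure; infer_instance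

lemma cubeMeasure_eq (N : ℕ) :
    cubeMeasure N = volume.restrict (Set.Icc (0 : Fin N → ℝ) 1) := by
  rw [cubeMeasure, ← Measure.restrict_pi_pi, ← Set.pi_univ_Icc]
  rfl

lemma measurable_evalSeries (a : ℕ → ℝ≥0∞) : Measurable (evalSeries a) := by
  unfold evalSeries
  fun_prop

lemma evalSeries_one (a : ℕ → ℝ≥0∞) : evalSeries a 1 = ∑' n, a n := by simp [evalSeries]

lemma evalSeries_zero (a : ℕ → ℝ≥0∞) : evalSeries a 0 = a 0 := by
  rw [evalSeries, tsum_eq_single 0]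
  · simp
  · intro n hn
    simp [hn]

/-- The action of a letter on `[0, 1]`: contraction by `x` towards `0` or towards `1`. -/
def blend (b : Bool) (x s : ℝ) : ℝ := if b then x * s else 1 - x * (1 - s)

lemma blend_mem (b : Bool) {x s : ℝ} (hx : x ∈ Set.Icc (0 : ℝ) 1) (hs : s ∈ Set.Icc (0 : ℝ) 1) :
    blend b x s ∈ Set.Icc (0 : ℝ) 1 := by
  obtain ⟨hx0, hx1⟩ := hx
  obtain ⟨hs0, hs1⟩ := hs
  unfold blend
  split_ifs <;> constructor <;> nlinarith

lemma continuous_blend (b : Bool) : Continuous fun p : ℝ × ℝ => blend b p.1 p.2 := by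
  cases b <;> simp only [blend, if_true, Bool.false_eq_true, if_false] <;> fun_prop

lemma lintegral_ofReal_Icc {f : ℝ → ℝ} (hf : Continuous f) (h0 : ∀ x ∈ Set.Icc (0 : ℝ) 1, 0 ≤ f x) :
    ∫⁻ x in Set.Icc (0 : ℝ) 1, ENNReal.ofReal (f x) = ENNReal.ofReal (∫ x in (0 : ℝ)..1, f x) := by
  rw [intervalIntegral.integral_of_le zero_le_one, ← integral_Icc_eq_integral_Ioc,
    ofReal_integral_eq_lintegral_ofReal hf.continuousOn.integrableOn_Icc]
  exact (ae_restrict_mem measurableSet_Icc).mono h0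

lemma integral_blend_false_pow (n : ℕ) (s : ℝ) :
    ∫ x in (0 : ℝ)..1, (1 - x * (1 - s)) ^ n = (∑ m ∈ Finset.range (n + 1), s ^ m) / (n + 1) := by
  -- The affine substitution degenerates at s = 1.
  by_cases hs : s = 1
  · subst hs
    simp
    field_simp
  · have h1 : 1 - s ≠ 0 := sub_ne_zero.2 (Ne.symm hs)
    have h := intervalIntegral.integral_comp_sub_mul (a := 0) (b := 1) (fun y : ℝ => y ^ n) h1 1
    simp only [mul_comm (1 - s)] at h
    rw [h, integral_pow, geom_sum_eq hs]
    have h2 : s - 1 ≠ 0 := sub_ne_zero.2 hs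
    simp only [zero_mul, sub_zero, one_mul, sub_sub_cancel, one_pow, smul_eq_mul]
    field_simp
    ring

lemma lintegral_evalSeries_blend (a : ℕ → ℝ≥0∞) (b : Bool) {s : ℝ} (hs : s ∈ Set.Icc (0 : ℝ) 1) :
    ∫⁻ x in Set.Icc (0 : ℝ) 1, evalSeries a (blend b x s) = evalSeries (letterStep b a) s := by
  have hcont : Continuous fun x => blend b x s :=
    (continuous_blend b).comp (continuous_id.prodMk continuous_const)
  unfold evalSeries
  rw [lintegral_tsum fun n => by fun_prop]
  have hn : ∀ n : ℕ, ENNReal.ofReal ((n : ℝ) + 1) = n + 1 := fun n => by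
    rw [ENNReal.ofReal_add (by positivity) (by positivity)]; simp
  have hterm : ∀ n : ℕ, ∫⁻ x in Set.Icc (0 : ℝ) 1, a n * ENNReal.ofReal (blend b x s ^ n) =
      a n * ENNReal.ofReal (∫ x in (0 : ℝ)..1, blend b x s ^ n) := fun n => by
    rw [lintegral_const_mul _ (by fun_prop), lintegral_ofReal_Icc (by fun_prop)]
    exact fun x hx => pow_nonneg (blend_mem b hx hs).1 n
  simp_rw [hterm]
  cases b
  · simp only [blend, letterStep, Bool.false_eq_true, if_false]
    rw [tsum_tailStep_mul]
    refine tsum_congr fun n => ?_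
    rw [integral_blend_false_pow, ENNReal.ofReal_div_of_pos (by positivity), hn,
      ENNReal.ofReal_sum_of_nonneg fun m _ => pow_nonneg hs.1 m]
    simp only [div_eq_mul_inv]
    ring
  · simp only [blend, letterStep, if_true, divStep]
    refine tsum_congr fun n => ?_
    simp_rw [mul_pow]
    rw [intervalIntegral.integral_mul_const, integral_pow]
    rw [ENNReal.ofReal_mul (by simp; positivity), ENNReal.ofReal_div_of_pos (by positivity), hn]
    simp only [div_eq_mul_inv]
    simp
    ring

/-- The composition of the blends given by the letters of `ω` and the coordinates of `x`. -/
def wordBlend : (ω : ℕ → Bool) → (N : ℕ) → (Fin N → ℝ) → ℝ → ℝ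
  | _, 0, _, e => e
  | ω, N + 1, x, e => blend (ω 0) (x 0) (wordBlend (fun j => ω (j + 1)) N (fun j => x j.succ) e)

lemma continuous_wordBlend (ω : ℕ → Bool) (N : ℕ) (e : ℝ) :
    Continuous fun x => wordBlend ω N x e := by
  induction N generalizing ω with
  | zero => exact continuous_const
  | succ N ih =>
    have h : Continuous fun x : Fin (N + 1) → ℝ =>
        (x 0, wordBlend (fun j => ω (j + 1)) N (fun j => x j.succ) e) :=
      (continuous_apply 0).prodMk
        ((ih fun j => ω (j + 1)).comp (continuous_pi fun j => continuous_apply j.succ))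
    exact (continuous_blend (ω 0)).comp h

lemma wordBlend_mem (ω : ℕ → Bool) (N : ℕ) {e : ℝ} (he : e ∈ Set.Icc (0 : ℝ) 1) {x : Fin N → ℝ}
    (hx : x ∈ Set.Icc (0 : Fin N → ℝ) 1) : wordBlend ω N x e ∈ Set.Icc (0 : ℝ) 1 := by
  induction N generalizing ω with
  | zero => exact he
  | succ N ih =>
    exact blend_mem _ ⟨hx.1 0, hx.2 0⟩ (ih _ ⟨fun j => hx.1 j.succ, fun j => hx.2 j.succ⟩)

/-- The outermost map uses the first coordinate. Integrating that coordinate first applies the first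
letter to `a` and leaves the shifted word. -/
lemma lintegral_evalSeries_wordBlend (a : ℕ → ℝ≥0∞) (ω : ℕ → Bool) (N : ℕ) {e : ℝ}
    (he : e ∈ Set.Icc (0 : ℝ) 1) :
    ∫⁻ x, evalSeries a (wordBlend ω N x e) ∂(cubeMeasure N) = evalSeries (wordSeq a ω N) e := by
  induction N generalizing ω a with
  | zero => simp [wordBlend, wordSeq, cubeMeasure]
  | succ N ih =>
    have hmp := measurePreserving_piFinSuccAbove
      (fun _ : Fin (N + 1) => (volume.restrict (Set.Icc (0 : ℝ) 1))) 0
    set F : ℝ × (Fin N → ℝ) → ℝ≥0∞ :=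
      fun p => evalSeries a (blend (ω 0) p.1 (wordBlend (fun j => ω (j + 1)) N p.2 e)) with hF
    have hFm : Measurable F := (measurable_evalSeries a).comp
      ((continuous_blend (ω 0)).comp (continuous_fst.prodMk
        ((continuous_wordBlend _ N e).comp continuous_snd))).measurable
    calc ∫⁻ x, evalSeries a (wordBlend ω (N + 1) x e) ∂(cubeMeasure (N + 1))
        = ∫⁻ p, F p ∂((volume.restrict (Set.Icc (0 : ℝ) 1)).prod (cubeMeasure N)) :=
          hmp.lintegral_comp hFm
      _ = ∫⁻ y, (∫⁻ x in Set.Icc (0 : ℝ) 1, F (x, y)) ∂(cubeMeasure N) :=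
          lintegral_prod_symm _ hFm.aemeasurable
      _ = ∫⁻ y, evalSeries (letterStep (ω 0) a) (wordBlend (fun j => ω (j + 1)) N y e)
            ∂(cubeMeasure N) := by
          refine lintegral_congr_ae ?_
          rw [cubeMeasure_eq]
          filter_upwards [ae_restrict_mem measurableSet_Icc] with y hy
          exact lintegral_evalSeries_blend a _ (wordBlend_mem _ N he hy)
      _ = _ := by rw [ih, wordSeq_succ']

/-! ### The alternating denominators -/

/-- The product of the coordinates of index less than `m`. -/
def initProd {N : ℕ} (x : Fin N → ℝ) (m : ℕ) : ℝ :=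
  ∏ j ∈ Finset.univ.filter (fun j : Fin N => (j : ℕ) < m), x j

lemma initProd_zero {N : ℕ} (x : Fin N → ℝ) : initProd x 0 = 1 := by simp [initProd]

lemma initProd_succ {N : ℕ} (x : Fin (N + 1) → ℝ) (m : ℕ) :
    initProd x (m + 1) = x 0 * initProd (fun j => x j.succ) m := by
  simp [initProd, Finset.prod_filter, Fin.prod_univ_succ]

lemma wordBlend_eq (ω : ℕ → Bool) (N : ℕ) (x : Fin N → ℝ) (e : ℝ) :
    wordBlend ω N x e = ∑ j ∈ Finset.range N,
      (if ω j then 0 else 1) * (initProd x j - initProd x (j + 1)) + initProd x N * e := by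
  induction N generalizing ω with
  | zero => simp [wordBlend, initProd_zero]
  | succ N ih =>
    rw [wordBlend, ih, Finset.sum_range_succ']
    simp only [initProd_succ, initProd_zero, ← mul_sub, mul_one]
    simp only [mul_left_comm _ (x 0), ← Finset.mul_sum]
    unfold blend
    split_ifs <;> ring

/-- The binary word whose runs end at the entries of `i`, starting with `true`. -/
noncomputable def runWord (i : ℕ → ℕ) (j : ℕ) : Bool := decide (Even (sInf {s | j < i s}))

lemma sInf_setOf_lt_eq {i : ℕ → ℕ} {j t : ℕ} (h : j < i t) (h' : ∀ s < t, i s ≤ j) :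
    sInf {s | j < i s} = t := by
  refine le_antisymm (Nat.sInf_le h) ?_
  by_contra! hlt
  have := Nat.sInf_mem (s := {s | j < i s}) ⟨t, h⟩
  exact absurd (h' _ hlt) (not_le.2 this)

lemma runWord_of_lt {i : ℕ → ℕ} {j : ℕ} (h : j < i 0) : runWord i j = true := by
  rw [runWord, sInf_setOf_lt_eq h (by simp)]
  simp

lemma runWord_of_mem {i : ℕ → ℕ} (hi : StrictMono i) {j t : ℕ} (h : i t ≤ j) (h' : j < i (t + 1)) :
    runWord i j = decide (Even (t + 1)) := by
  rw [runWord, sInf_setOf_lt_eq h' fun s hs => (hi.monotone (Nat.lt_succ_iff.1 hs)).trans h]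

/-- The differences telescope over each run of `false`, and runs of `true` contribute nothing. The
last term accounts for a run of `false` still to come. -/
lemma alternating_sum_initProd_eq {i : ℕ → ℕ} (hi : StrictMono i) (p : ℕ → ℝ) (r : ℕ) :
    1 + ∑ s ∈ Finset.range (r + 1), (-1) ^ (s + 1) * p (i s) =
      1 - (∑ j ∈ Finset.range (i r), (if runWord i j then 0 else 1) * (p j - p (j + 1))
        + p (i r) * (if Even r then 1 else 0)) := by
  induction r with
  | zero =>
    have hz : ∑ j ∈ Finset.range (i 0), (if runWord i j then (0 : ℝ) else 1) * (p j - p (j + 1)) = 0 :=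
      Finset.sum_eq_zero fun j hj => by rw [runWord_of_lt (Finset.mem_range.1 hj)]; simp
    rw [hz]
    simp
    ring
  | succ r ih =>
    rw [Finset.sum_range_succ, ← add_assoc, ih, ← Finset.sum_range_add_sum_Ico _ (hi.monotone r.le_succ)]
    have hb : ∑ j ∈ Finset.Ico (i r) (i (r + 1)), (if runWord i j then (0 : ℝ) else 1) * (p j - p (j + 1)) =
        (if Even r then 1 else 0) * (p (i r) - p (i (r + 1))) := by
      have ht : ∑ j ∈ Finset.Ico (i r) (i (r + 1)), (p j - p (j + 1)) = p (i r) - p (i (r + 1)) := by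
        rw [Finset.sum_Ico_eq_sub _ (hi.monotone r.le_succ), Finset.sum_range_sub',
          Finset.sum_range_sub']
        ring
      rw [← ht, Finset.mul_sum]
      refine Finset.sum_congr rfl fun j hj => ?_
      obtain ⟨h1, h2⟩ := Finset.mem_Ico.1 hj
      rw [runWord_of_mem hi h1 h2]
      by_cases h : Even r <;> simp [Nat.even_add_one, h]
    rw [hb]
    by_cases h : Even r
    · simp [h, Nat.even_add_one, pow_succ, h.neg_one_pow]
      ring
    · simp [h, Nat.even_add_one, pow_succ, (Nat.not_even_iff_odd.1 h).neg_one_pow]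
      ring

lemma altDenom_eq {i : ℕ → ℕ} (hi : StrictMono i) (r : ℕ) (x : Fin (i r) → ℝ) :
    altDenom i r x = 1 - wordBlend (runWord i) (i r) x (if Even r then 1 else 0) := by
  rw [wordBlend_eq, ← alternating_sum_initProd_eq hi (initProd x)]
  rfl

/-! ### Positivity of the denominators and the value of the integrals. -/

lemma ae_wordBlend_lt_one (ω : ℕ → Bool) (h0 : ω 0 = true) (N : ℕ) {e : ℝ}
    (he : e ∈ Set.Icc (0 : ℝ) 1) :
    ∀ᵐ x ∂(cubeMeasure (N + 1)), wordBlend ω (N + 1) x e ∈ Set.Ico (0 : ℝ) 1 := by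
  have h1 : ∀ᵐ x ∂(cubeMeasure (N + 1)), x ∈ Set.Icc (0 : Fin (N + 1) → ℝ) 1 := by
    rw [cubeMeasure_eq]
    exact ae_restrict_mem measurableSet_Icc
  have h2 : ∀ᵐ x ∂(cubeMeasure (N + 1)), x 0 ≠ 1 :=
    Measure.ae_eval_ne (μ := fun _ : Fin (N + 1) => volume.restrict (Set.Icc (0 : ℝ) 1)) 0 1
  filter_upwards [h1, h2] with x hx hx1
  have hx0 : x 0 < 1 := lt_of_le_of_ne (hx.2 0) hx1
  have ht := wordBlend_mem (fun j => ω (j + 1)) N he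
    (x := fun j => x j.succ) ⟨fun j => hx.1 j.succ, fun j => hx.2 j.succ⟩
  refine ⟨(wordBlend_mem ω (N + 1) he hx).1, ?_⟩
  rw [wordBlend, h0, blend, if_pos rfl]
  have := hx.1 0
  simp only [Pi.zero_apply] at this
  nlinarith [ht.1, ht.2]

lemma evalSeries_one_of_mem {s : ℝ} (hs : s ∈ Set.Ico (0 : ℝ) 1) :
    evalSeries 1 s = ENNReal.ofReal (1 / (1 - s)) := by
  simp only [evalSeries, Pi.one_apply, one_mul]
  rw [← ENNReal.ofReal_tsum_of_nonneg (fun n => pow_nonneg hs.1 n)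
    (summable_geometric_of_lt_one hs.1 hs.2), tsum_geometric_of_lt_one hs.1 hs.2, one_div]

lemma altDenom_pos_ae {i : ℕ → ℕ} (hi : i ∈ alternatingSequences) (r : ℕ) :
    ∀ᵐ x ∂(volume.restrict (Set.Icc (0 : Fin (i r) → ℝ) 1)), 0 < altDenom i r x ∧
      ENNReal.ofReal (1 / altDenom i r x) =
        evalSeries 1 (wordBlend (runWord i) (i r) x (if Even r then 1 else 0)) := by
  have he : (if Even r then (1 : ℝ) else 0) ∈ Set.Icc (0 : ℝ) 1 := by split_ifs <;> simp
  have hpos : 0 < i r := lt_of_lt_of_le hi.1 (hi.2.monotone r.zero_le)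
  have key : ∀ N, 0 < N → ∀ᵐ x ∂(cubeMeasure N),
      wordBlend (runWord i) N x (if Even r then 1 else 0) ∈ Set.Ico (0 : ℝ) 1 := by
    intro N hN
    obtain ⟨N, rfl⟩ := Nat.exists_eq_succ_of_ne_zero hN.ne'
    exact ae_wordBlend_lt_one _ (runWord_of_lt hi.1) N he
  rw [← cubeMeasure_eq]
  filter_upwards [key _ hpos] with x hx
  rw [altDenom_eq hi.2]
  exact ⟨sub_pos.2 hx.2, (evalSeries_one_of_mem hx).symm⟩

lemma lintegral_altDenom {i : ℕ → ℕ} (hi : i ∈ alternatingSequences) (r : ℕ) :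
    ∫⁻ x in Set.Icc (0 : Fin (i r) → ℝ) 1, ENNReal.ofReal (1 / altDenom i r x) =
      if Even r then ∑' n, wordSeq 1 (runWord i) (i r) n else wordSeq 1 (runWord i) (i r) 0 := by
  rw [lintegral_congr_ae ((altDenom_pos_ae hi r).mono fun x hx => hx.2), ← cubeMeasure_eq,
    lintegral_evalSeries_wordBlend _ _ _ (by split_ifs <;> simp)]
  split_ifs
  · exact evalSeries_one _
  · exact evalSeries_zero _

lemma continuous_altDenom (i : ℕ → ℕ) (r : ℕ) : Continuous (altDenom i r) := by
  unfold altDenom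
  fun_prop

lemma integrableOn_altDenom {i : ℕ → ℕ} (hi : i ∈ alternatingSequences) (r : ℕ)
    (h : (if Even r then ∑' n, wordSeq 1 (runWord i) (i r) n
      else wordSeq 1 (runWord i) (i r) 0) ≠ ∞) :
    IntegrableOn (fun x => 1 / altDenom i r x) (Set.Icc (0 : Fin (i r) → ℝ) 1) := by
  refine ⟨((continuous_altDenom i r).measurable.const_div 1).aestronglyMeasurable, ?_⟩
  rw [hasFiniteIntegral_iff_ofReal ((altDenom_pos_ae hi r).mono fun x hx => (one_div_pos.2 hx.1).le),
    lintegral_altDenom hi]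
  exact h.lt_top

lemma altIntegral_eq {i : ℕ → ℕ} (hi : i ∈ alternatingSequences) (r : ℕ) :
    altIntegral i r = (if Even r then ∑' n, wordSeq 1 (runWord i) (i r) n
      else wordSeq 1 (runWord i) (i r) 0).toReal := by
  rw [altIntegral, integral_eq_lintegral_of_nonneg_ae
    ((altDenom_pos_ae hi r).mono fun x hx => (one_div_pos.2 hx.1).le)
    ((continuous_altDenom i r).measurable.const_div 1).aestronglyMeasurable, lintegral_altDenom hi]

/-! ### Nested intervals -/

lemma le_letterStep_zero (b : Bool) (a : ℕ → ℝ≥0∞) : a 0 ≤ letterStep b a 0 := by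
  cases b
  · exact le_tailStep_zero a
  · exact (divStep_zero a).ge

lemma tailStep_zero_le_tsum (a : ℕ → ℝ≥0∞) : tailStep a 0 ≤ ∑' n, a n := by
  rw [← tsum_tailStep]
  exact ENNReal.le_tsum 0

lemma tsum_letterStep_le (b : Bool) (a : ℕ → ℝ≥0∞) : ∑' n, letterStep b a n ≤ ∑' n, a n := by
  cases b
  · exact (tsum_tailStep a).le
  · exact (tsum_divStep a).trans_le (tailStep_zero_le_tsum a)

lemma wordSeq_zero_mono (ω : ℕ → Bool) : Monotone fun n => wordSeq 1 ω n 0 :=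
  monotone_nat_of_le_succ fun _ => le_letterStep_zero _ _

lemma tsum_wordSeq_anti (ω : ℕ → Bool) : Antitone fun n => ∑' m, wordSeq 1 ω n m :=
  antitone_nat_of_succ_le fun _ => tsum_letterStep_le _ _

lemma wordSeq_zero_le_tsum (ω : ℕ → Bool) (m n : ℕ) :
    wordSeq 1 ω m 0 ≤ ∑' k, wordSeq 1 ω n k :=
  calc wordSeq 1 ω m 0 ≤ wordSeq 1 ω (max m n) 0 := wordSeq_zero_mono ω (le_max_left m n)
    _ ≤ ∑' k, wordSeq 1 ω (max m n) k := ENNReal.le_tsum 0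
    _ ≤ _ := tsum_wordSeq_anti ω (le_max_right m n)

/-- The point `v` lies in the open interval attached to the first `n` letters of `ω`. -/
def Inside (ω : ℕ → Bool) (n : ℕ) (v : ℝ≥0∞) : Prop :=
  wordSeq 1 ω n 0 < v ∧ v < ∑' m, wordSeq 1 ω n m

lemma Inside.of_succ {ω : ℕ → Bool} {n : ℕ} {v : ℝ≥0∞} (h : Inside ω (n + 1) v) : Inside ω n v :=
  ⟨(wordSeq_zero_mono ω n.le_succ).trans_lt h.1, h.2.trans_le (tsum_wordSeq_anti ω n.le_succ)⟩

lemma Inside.lt_of_true {ω : ℕ → Bool} {n : ℕ} {v : ℝ≥0∞} (h : Inside ω (n + 1) v)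
    (hn : ω n = true) : v < tailStep (wordSeq 1 ω n) 0 := by
  have h2 := h.2
  rwa [wordSeq, hn, letterStep, if_pos rfl, tsum_divStep] at h2

lemma Inside.lt_of_false {ω : ℕ → Bool} {n : ℕ} {v : ℝ≥0∞} (h : Inside ω (n + 1) v)
    (hn : ω n = false) : tailStep (wordSeq 1 ω n) 0 < v := by
  simpa only [wordSeq, hn, letterStep, Bool.false_eq_true, if_false] using h.1

lemma Inside.ne {ω : ℕ → Bool} {n : ℕ} {v : ℝ≥0∞} (h : Inside ω (n + 1) v) :
    v ≠ tailStep (wordSeq 1 ω n) 0 := by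
  cases hn : ω n
  · exact (h.lt_of_false hn).ne'
  · exact (h.lt_of_true hn).ne

/-- After a common prefix the split point is the same, and the side on which `v` lies dictates the
next letter. -/
lemma Inside.agree {ω η : ℕ → Bool} {n : ℕ} {v : ℝ≥0∞} (h : Inside ω n v) (h' : Inside η n v) :
    ∀ j < n, ω j = η j := by
  induction n with
  | zero => simp
  | succ n ih =>
    have hlt := ih h.of_succ h'.of_succ
    intro j hj
    rcases Nat.lt_succ_iff_lt_or_eq.1 hj with hj | rfl
    · exact hlt j hj
    · have heq := wordSeq_congr 1 hlt
      cases hω : ω j <;> cases hη : η j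
      · rfl
      · have h1 := h.lt_of_false hω
        have h2 := h'.lt_of_true hη
        rw [heq] at h1
        exact absurd h1 h2.not_gt
      · have h1 := h.lt_of_true hω
        have h2 := h'.lt_of_false hη
        rw [heq] at h1
        exact absurd h1 h2.not_gt
      · rfl

lemma wordSeq_ne_top {ω : ℕ → Bool} (h0 : ω 0 = true) (n m : ℕ) : wordSeq 1 ω n m ≠ ∞ := by
  cases n with
  | zero => exact ENNReal.one_ne_top
  | succ n => exact (isReg_wordSeq h0 n).ne_top m

lemma tsum_wordSeq_ne_top {ω : ℕ → Bool} (h0 : ω 0 = true) {n : ℕ} (hn : 0 < n) (h : ω n = true) :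
    ∑' m, wordSeq 1 ω (n + 1) m ≠ ∞ := by
  obtain ⟨n, rfl⟩ := Nat.exists_eq_succ_of_ne_zero hn.ne'
  rw [wordSeq, h]
  exact (isReg_wordSeq h0 n).tsum_divStep_ne_top

/-- The limit `c` of these decreasing lengths satisfies 2c ≤ c by repeated halving. It is finite
because a second `true` makes the total sum finite. -/
lemma tendsto_tailSum_wordSeq {ω : ℕ → Bool} (h0 : ω 0 = true) (h : ∃ᶠ n in atTop, ω n = true) :
    Tendsto (fun n => tailSum (wordSeq 1 ω n)) atTop (𝓝 0) := by
  have hanti : Antitone fun n => tailSum (wordSeq 1 ω n) := by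
    refine antitone_nat_of_succ_le fun n => ?_
    rw [wordSeq]
    cases ω n
    · exact tailSum_tailStep_le (wordSeq_ne_top h0 n 0)
    · exact (tailSum_divStep_le _).trans ENNReal.half_le_self
  have hlim := tendsto_atTop_iInf hanti
  set c := ⨅ n, tailSum (wordSeq 1 ω n) with hc
  rw [frequently_atTop] at h
  have hfin : c ≠ ∞ := by
    obtain ⟨n, hn, hωn⟩ := h 1
    refine ((iInf_le _ (n + 1)).trans_lt ?_).ne
    exact (tailSum_le_tsum _).trans_lt (tsum_wordSeq_ne_top h0 hn hωn).lt_top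
  have hle : c * 2 ≤ c := by
    refine le_iInf fun n => ?_
    obtain ⟨m, hm, hωm⟩ := h n
    rw [← ENNReal.le_div_iff_mul_le (by simp) (by simp)]
    calc c ≤ tailSum (wordSeq 1 ω (m + 1)) := iInf_le _ _
      _ ≤ tailSum (wordSeq 1 ω m) / 2 := by
        rw [wordSeq, hωm]
        exact tailSum_divStep_le _
      _ ≤ _ := by
        gcongr
        exact hanti hm
  have hzero : c = 0 := by
    by_contra hne
    rw [mul_two] at hle
    exact absurd hle (not_le.2 (ENNReal.lt_add_right hfin hne))
  rwa [hzero] at hlim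

/-- A later `false` strictly raises the lower endpoint and a later `true` strictly lowers the upper
one. -/
lemma inside_of_le {ω : ℕ → Bool} (h0 : ω 0 = true) (ht : ∃ᶠ n in atTop, ω n = true)
    (hf : ∃ᶠ n in atTop, ω n = false) {v : ℝ≥0∞} (h : ∀ n, wordSeq 1 ω n 0 ≤ v)
    (h' : ∀ n, v ≤ ∑' m, wordSeq 1 ω n m) (n : ℕ) : Inside ω n v := by
  rw [frequently_atTop] at ht hf
  constructor
  · obtain ⟨m, hm, hωm⟩ := hf (n + 1)
    obtain ⟨m, rfl⟩ : ∃ k, m = k + 1 := ⟨m - 1, by omega⟩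
    calc wordSeq 1 ω n 0 ≤ wordSeq 1 ω (m + 1) 0 := wordSeq_zero_mono ω (by omega)
      _ < wordSeq 1 ω (m + 1 + 1) 0 := by
        rw [wordSeq.eq_2 _ _ (m + 1), hωm]
        exact (isReg_wordSeq h0 m).lt_tailStep_zero
      _ ≤ v := h _
  · obtain ⟨m, hm, hωm⟩ := ht (n + 1)
    obtain ⟨m, rfl⟩ : ∃ k, m = k + 1 := ⟨m - 1, by omega⟩
    calc v ≤ ∑' k, wordSeq 1 ω (m + 1 + 1) k := h' _
      _ < ∑' k, wordSeq 1 ω (m + 1) k := by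
        rw [wordSeq, hωm, letterStep, if_pos rfl, tsum_divStep]
        exact (isReg_wordSeq h0 m).tailStep_zero_lt
      _ ≤ _ := tsum_wordSeq_anti ω (by omega)

lemma exists_wordSeq_limit {ω : ℕ → Bool} (h0 : ω 0 = true) (ht : ∃ᶠ n in atTop, ω n = true)
    (hf : ∃ᶠ n in atTop, ω n = false) :
    ∃ v : ℝ≥0∞, (∀ n, Inside ω n v) ∧ Tendsto (fun n => wordSeq 1 ω n 0) atTop (𝓝 v) ∧
      Tendsto (fun n => ∑' m, wordSeq 1 ω n m) atTop (𝓝 v) := by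
  have hlim := tendsto_atTop_iSup (wordSeq_zero_mono ω)
  refine ⟨_, inside_of_le h0 ht hf (fun n => le_iSup (fun n => wordSeq 1 ω n 0) n)
    (fun n => iSup_le fun m => wordSeq_zero_le_tsum ω m n), hlim, ?_⟩
  simp_rw [tsum_eq_zero_add_tailSum]
  simpa using hlim.add (tendsto_tailSum_wordSeq h0 ht)

lemma Inside.unique {ω : ℕ → Bool} (h0 : ω 0 = true) (ht : ∃ᶠ n in atTop, ω n = true)
    (hf : ∃ᶠ n in atTop, ω n = false) {v w : ℝ≥0∞} (hv : ∀ n, Inside ω n v)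
    (hw : ∀ n, Inside ω n w) : v = w := by
  obtain ⟨u, -, hL, hH⟩ := exists_wordSeq_limit h0 ht hf
  have key : ∀ v, (∀ n, Inside ω n v) → v = u := fun v hv =>
    le_antisymm (ge_of_tendsto' hH fun n => (hv n).2.le) (le_of_tendsto' hL fun n => (hv n).1.le)
  rw [key v hv, key w hw]

/-! ### Words with given runs -/

lemma runWord_apply_self {i : ℕ → ℕ} (hi : StrictMono i) (t : ℕ) :
    runWord i (i t) = decide (Even (t + 1)) :=
  runWord_of_mem hi le_rfl (hi t.lt_succ_self)

lemma frequently_runWord_true {i : ℕ → ℕ} (hi : StrictMono i) :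
    ∃ᶠ n in atTop, runWord i n = true := by
  rw [frequently_atTop]
  intro n
  refine ⟨i (2 * n + 1), (by omega : n ≤ 2 * n + 1).trans (hi.le_apply), ?_⟩
  rw [runWord_apply_self hi, decide_eq_true_iff]
  exact ⟨n + 1, by ring⟩

lemma frequently_runWord_false {i : ℕ → ℕ} (hi : StrictMono i) :
    ∃ᶠ n in atTop, runWord i n = false := by
  rw [frequently_atTop]
  intro n
  refine ⟨i (2 * n), (by omega : n ≤ 2 * n).trans (hi.le_apply), ?_⟩
  rw [runWord_apply_self hi, decide_eq_false_iff_not, Nat.not_even_iff_odd]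
  exact ⟨n, rfl⟩

lemma runWord_ne_of_lt {i i' : ℕ → ℕ} (hi : StrictMono i) {s : ℕ} (h : ∀ t < s, i t = i' t)
    (hs : i s < i' s) : runWord i (i s) ≠ runWord i' (i s) := by
  rw [runWord_apply_self hi, runWord, sInf_setOf_lt_eq hs fun t ht => h t ht ▸ (hi ht).le]
  simp only [ne_eq, decide_eq_decide, Nat.even_add_one]
  tauto

lemma runWord_injOn : Set.InjOn runWord alternatingSequences := by
  intro i hi i' hi' heq
  funext s
  induction s using Nat.strong_induction_on with
  | _ s ih =>
    rcases lt_trichotomy (i s) (i' s) with h | h | h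
    · exact absurd (congrFun heq _) (runWord_ne_of_lt hi.2 ih h)
    · exact h
    · exact absurd (congrFun heq _).symm (runWord_ne_of_lt hi'.2 (fun t ht => (ih t ht).symm) h)

/-- The entries of `i` are the positions just after which the letter has changed; the parity of the
number of earlier changes recovers the letter. -/
lemma exists_runWord_eq {ω : ℕ → Bool} (h0 : ω 0 = true) (ht : ∃ᶠ n in atTop, ω n = true)
    (hf : ∃ᶠ n in atTop, ω n = false) : ∃ i ∈ alternatingSequences, runWord i = ω := by
  classical
  set p : ℕ → Prop := fun j => ω j ≠ ω (j + 1) with hp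
  have hconst : ∀ N, (∀ j ≥ N, ¬ p j) → ∀ j ≥ N, ω j = ω N := by
    intro N hN j hj
    induction j, hj using Nat.le_induction with
    | base => rfl
    | succ j hj ih => rw [← ih]; exact (not_not.1 (hN j hj)).symm
  have hinf : {j | p j}.Infinite := by
    rw [← Nat.frequently_atTop_iff_infinite, frequently_atTop]
    by_contra! hcon
    obtain ⟨N, hN⟩ := hcon
    have h := hconst N hN
    rw [frequently_atTop] at ht hf
    obtain ⟨a, ha, ha'⟩ := ht N
    obtain ⟨b, hb, hb'⟩ := hf N
    have := (h a ha).trans (h b hb).symm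
    simp [ha', hb'] at this
  refine ⟨fun s => Nat.nth p s + 1, ⟨Nat.le_add_left _ _, fun s t hst =>
    Nat.add_lt_add_right (Nat.nth_strictMono hinf hst) 1⟩, ?_⟩
  have hcount : ∀ j, (decide (Even (Nat.count p j))) = ω j := by
    intro j
    induction j with
    | zero => simp [h0]
    | succ j ih =>
      rw [Nat.count_succ]
      by_cases hj : p j
      · rw [if_pos hj]
        simp only [Nat.even_add_one]
        have hj' : ω j ≠ ω (j + 1) := hj
        rw [decide_not, ih]
        cases h1 : ω j <;> cases h2 : ω (j + 1) <;> simp_all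
      · rw [if_neg hj, add_zero, ih]
        exact not_not.1 hj
  funext j
  have hset : {s | j < Nat.nth p s + 1} = Set.Ici (Nat.count p j) := by
    ext s
    rw [Set.mem_ofPred_eq, Nat.lt_succ_iff, Set.mem_Ici, Nat.count_le_iff_le_nth hinf]
  rw [runWord, hset, csInf_Ici, hcount]

/-! ### The limit of the alternating integrals -/

lemma altIntegral_limit {i : ℕ → ℕ} (hi : i ∈ alternatingSequences) :
    Tendsto (altIntegral i) atTop (𝓝 (xi i)) ∧
      ∀ n, Inside (runWord i) n (ENNReal.ofReal (xi i)) := by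
  obtain ⟨v, hv, hL, hH⟩ := exists_wordSeq_limit (runWord_of_lt hi.1)
    (frequently_runWord_true hi.2) (frequently_runWord_false hi.2)
  have hfin : v ≠ ∞ := (hv 0).2.ne_top
  have hlim : Tendsto (altIntegral i) atTop (𝓝 v.toReal) := by
    have h1 : Tendsto (fun r => ∑' n, wordSeq 1 (runWord i) (i r) n) atTop (𝓝 v) :=
      hH.comp hi.2.tendsto_atTop
    have h2 : Tendsto (fun r => wordSeq 1 (runWord i) (i r) 0) atTop (𝓝 v) :=
      hL.comp hi.2.tendsto_atTop
    refine ((ENNReal.tendsto_toReal hfin).comp (h1.if' (p := Even) h2)).congr fun r => ?_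
    exact (altIntegral_eq hi r).symm
  have hxi : xi i = v.toReal := hlim.limUnder_eq
  rw [hxi, ENNReal.ofReal_toReal hfin]
  exact ⟨hlim, hv⟩

lemma integrableOn_altDenom_of_pos {i : ℕ → ℕ} (hi : i ∈ alternatingSequences) {r : ℕ}
    (hr : 1 ≤ r) :
    IntegrableOn (fun x => 1 / altDenom i r x) (Set.Icc (0 : Fin (i r) → ℝ) 1) := by
  refine integrableOn_altDenom hi r ?_
  have h0 := runWord_of_lt hi.1
  split_ifs with h
  -- For even `r` the total sum is needed. As `r` is at least 2, the second run of `true` has begun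
  -- before `i r`, which makes this sum finite.
  · have h1 : runWord i (i 1) = true := by
      rw [runWord_apply_self hi.2]
      decide
    have hr2 : 1 < r := lt_of_le_of_ne hr fun h' => by subst h'; simp at h
    refine ((tsum_wordSeq_anti (runWord i) (hi.2 hr2)).trans_lt ?_).ne
    exact (tsum_wordSeq_ne_top h0 (hi.1.trans (hi.2.monotone zero_le_one)) h1).lt_top
  · exact wordSeq_ne_top h0 _ _

/-! ### Greedy expansions -/

/-- The sequences produced by the greedy expansion of `v`. -/
noncomputable def greedySeq (v : ℝ≥0∞) : ℕ → ℕ → ℝ≥0∞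
  | 0 => 1
  | n + 1 => letterStep (decide (v < tailStep (greedySeq v n) 0)) (greedySeq v n)

/-- The letters of the greedy expansion of `v`. -/
noncomputable def greedyWord (v : ℝ≥0∞) (n : ℕ) : Bool := decide (v < tailStep (greedySeq v n) 0)

lemma wordSeq_greedyWord (v : ℝ≥0∞) (n : ℕ) : wordSeq 1 (greedyWord v) n = greedySeq v n := by
  induction n with
  | zero => rfl
  | succ n ih => rw [wordSeq, ih, greedySeq, greedyWord]

lemma tsum_one_eq_top : ∑' n, (1 : ℕ → ℝ≥0∞) n = ∞ := by
  simp

lemma tailStep_one_zero : tailStep 1 0 = ∞ := by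
  have h : ∀ m : ℕ, (1 : ℝ≥0∞) / (m + 1) = ENNReal.ofReal (1 / ((m : ℝ) + 1)) := fun m => by
    rw [ENNReal.ofReal_div_of_pos (by positivity), ENNReal.ofReal_add (by positivity) (by positivity)]
    simp
  simp only [tailStep, zero_le, if_true, Pi.one_apply, h]
  by_contra hne
  refine Real.not_summable_one_div_natCast ((summable_nat_add_iff 1).1 ?_)
  have := ENNReal.summable_toReal hne
  refine this.congr fun m => ?_
  rw [ENNReal.toReal_ofReal (by positivity)]
  push_cast
  rfl

lemma greedyWord_zero {v : ℝ≥0∞} (hv : v ≠ ∞) : greedyWord v 0 = true := by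
  rw [greedyWord, greedySeq, tailStep_one_zero]
  simpa using hv.lt_top

lemma inside_greedyWord {v : ℝ≥0∞} (hv1 : 1 < v) (hv : v ≠ ∞)
    (h : ∀ n, v ≠ tailStep (wordSeq 1 (greedyWord v) (n + 1)) 0) (n : ℕ) :
    Inside (greedyWord v) n v := by
  -- The split point of the empty word is the harmonic series, hence infinite.
  have h' : ∀ n, v ≠ tailStep (wordSeq 1 (greedyWord v) n) 0 := by
    intro n
    cases n with
    | zero => rw [wordSeq, tailStep_one_zero]; exact hv
    | succ n => exact h n
  induction n with
  | zero => exact ⟨hv1, by rw [wordSeq, tsum_one_eq_top]; exact hv.lt_top⟩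
  | succ n ih =>
    have hn := h' n
    unfold Inside
    cases hω : greedyWord v n
    · rw [greedyWord, decide_eq_false_iff_not, ← wordSeq_greedyWord] at hω
      have hω' : greedyWord v n = false := by
        rwa [greedyWord, decide_eq_false_iff_not, ← wordSeq_greedyWord]
      rw [wordSeq, hω', letterStep, if_neg (by simp), tsum_tailStep]
      exact ⟨lt_of_le_of_ne (not_lt.1 hω) hn.symm, ih.2⟩
    · rw [greedyWord, decide_eq_true_iff, ← wordSeq_greedyWord] at hω
      have hω' : greedyWord v n = true := by
        rwa [greedyWord, decide_eq_true_iff, ← wordSeq_greedyWord]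
      rw [wordSeq, hω', letterStep, if_pos rfl, tsum_divStep, divStep_zero]
      exact ⟨ih.1, hω⟩

lemma Inside.frequently_true {ω : ℕ → Bool} (h0 : ω 0 = true) {v : ℝ≥0∞} (h : ∀ n, Inside ω n v) :
    ∃ᶠ n in atTop, ω n = true := by
  rw [frequently_atTop]
  by_contra! hcon
  obtain ⟨N, hN⟩ := hcon
  have hiter : ∀ k, wordSeq 1 ω (N + k) = tailStep^[k] (wordSeq 1 ω N) := by
    intro k
    induction k with
    | zero => rfl
    | succ k ih =>
      rw [Function.iterate_succ_apply', ← ih, ← add_assoc, wordSeq, letterStep, if_neg (hN _ (by omega))]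
  obtain ⟨k, hk⟩ := exists_lt_iterate_tailStep (wordSeq_ne_top h0 N) (h N).2
  rw [← hiter] at hk
  exact absurd hk (h _).1.not_gt

lemma Inside.frequently_false {ω : ℕ → Bool} (h0 : ω 0 = true) {v : ℝ≥0∞} (h : ∀ n, Inside ω n v) :
    ∃ᶠ n in atTop, ω n = false := by
  have hlim := tendsto_tailSum_wordSeq h0 (Inside.frequently_true h0 h)
  rw [frequently_atTop]
  by_contra! hcon
  obtain ⟨N, hN⟩ := hcon
  have hconst : ∀ k, wordSeq 1 ω (N + k) 0 = wordSeq 1 ω N 0 := by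
    intro k
    induction k with
    | zero => rfl
    | succ k ih =>
      rw [← ih, ← add_assoc, wordSeq, letterStep,
        if_pos (Bool.not_eq_false _ ▸ hN (N + k) (by omega)), divStep_zero]
  have hv : ∀ k, v ≤ wordSeq 1 ω N 0 + tailSum (wordSeq 1 ω (k + N)) := by
    intro k
    rw [← hconst k, add_comm k N, ← tsum_eq_zero_add_tailSum]
    exact (h _).2.le
  have hle := ge_of_tendsto' (((tendsto_add_atTop_iff_nat N).2 hlim).const_add (wordSeq 1 ω N 0)) hv
  rw [add_zero] at hle
  exact absurd (h N).1 hle.not_gt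

/-! ### Multiple zeta-star values -/

open Classical in
/-- The multiple zeta-star series restricted to summation indices larger than `m`. -/
noncomputable def zetaStarTail {d : ℕ} (k : Fin d → ℕ) (m : ℕ) : ℝ≥0∞ :=
  ∑' n : Fin d → ℕ, if Antitone n ∧ ∀ j, m + 1 ≤ n j then ∏ j, ((n j : ℝ≥0∞) ^ k j)⁻¹ else 0

lemma zetaStar_eq {d : ℕ} (k : Fin d → ℕ) : zetaStar k = (zetaStarTail k 0).toReal := by
  classical
  have h : zetaStarTail k 0 = ∑' n : {n : Fin d → ℕ // Antitone n ∧ ∀ j, 1 ≤ n j},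
      ∏ j, ((n.1 j : ℝ≥0∞) ^ k j)⁻¹ := by
    have := tsum_subtype {n : Fin d → ℕ | Antitone n ∧ ∀ j, 1 ≤ n j}
      (fun n => ∏ j, ((n j : ℝ≥0∞) ^ k j)⁻¹)
    refine Eq.trans ?_ this.symm
    refine tsum_congr fun n => ?_
    simp only [Set.indicator_apply, Set.mem_ofPred_eq, zero_add]
  rw [h, ENNReal.tsum_toReal_eq, zetaStar]
  · refine tsum_congr fun n => ?_
    rw [ENNReal.toReal_prod]
    refine Finset.prod_congr rfl fun j _ => ?_
    simp
  · intro n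
    refine ENNReal.prod_ne_top fun j _ => ?_
    have := n.2.2 j
    exact ENNReal.inv_ne_top.2 (pow_ne_zero _ (by exact_mod_cast (by omega : n.1 j ≠ 0)))

lemma zetaStarTail_zero (k : Fin 0 → ℕ) : zetaStarTail k = 1 := by
  funext m
  rw [zetaStarTail, tsum_eq_single default fun n hn => absurd (Subsingleton.elim _ _) hn]
  simp [Subsingleton.antitone]

lemma antitone_snoc_iff {d : ℕ} (n : Fin d → ℕ) (l m : ℕ) :
    (Antitone (Fin.snoc n l : Fin (d + 1) → ℕ) ∧
      ∀ j, m ≤ (Fin.snoc n l : Fin (d + 1) → ℕ) j) ↔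
      m ≤ l ∧ Antitone n ∧ ∀ j, l ≤ n j := by
  constructor
  · rintro ⟨h1, h2⟩
    refine ⟨by simpa using h2 (Fin.last d), fun a b hab => ?_, fun j => ?_⟩
    · simpa using h1 (Fin.castSucc_le_castSucc_iff.2 hab)
    · simpa using h1 (Fin.le_last j.castSucc)
  · rintro ⟨h1, h2, h3⟩
    refine ⟨fun a b hab => ?_, fun j => ?_⟩
    · induction b using Fin.lastCases with
      | last =>
        induction a using Fin.lastCases with
        | last => rfl
        | cast a => simpa using h3 a
      | cast b =>
        induction a using Fin.lastCases with
        | last => exact absurd hab (not_le.2 (Fin.castSucc_lt_last b))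
        | cast a => simpa using h2 (Fin.castSucc_le_castSucc_iff.1 hab)
    · induction j using Fin.lastCases with
      | last => simpa using h1
      | cast j => simpa using h1.trans (h3 j)

lemma divStep_iterate (a : ℕ → ℝ≥0∞) (p m : ℕ) :
    (divStep^[p] a) m = a m * (((m : ℝ≥0∞) + 1) ^ p)⁻¹ := by
  induction p with
  | zero => simp
  | succ p ih =>
    rw [Function.iterate_succ_apply', divStep, ih, pow_succ, div_eq_mul_inv, mul_assoc,
      ENNReal.mul_inv (Or.inr (by finiteness)) (Or.inr (by simp))]

/-- Summing last over the smallest index l + 1, the factor (l + 1)^(-(p + 1)) is `p` divisions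
together with the one inside `tailStep`. -/
lemma zetaStarTail_snoc {d : ℕ} (k : Fin d → ℕ) (p : ℕ) :
    zetaStarTail (Fin.snoc k (p + 1) : Fin (d + 1) → ℕ) =
      tailStep (divStep^[p] (zetaStarTail k)) := by
  classical
  funext m
  have hterm : ∀ (l : ℕ) (n : Fin d → ℕ),
      (if Antitone (Fin.snoc n l : Fin (d + 1) → ℕ) ∧
          ∀ j, m + 1 ≤ (Fin.snoc n l : Fin (d + 1) → ℕ) j then
        ∏ j, (((Fin.snoc n l : Fin (d + 1) → ℕ) j : ℝ≥0∞) ^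
          (Fin.snoc k (p + 1) : Fin (d + 1) → ℕ) j)⁻¹ else 0) =
      if m + 1 ≤ l then (if Antitone n ∧ ∀ j, l ≤ n j then ∏ j, ((n j : ℝ≥0∞) ^ k j)⁻¹ else 0) *
        ((l : ℝ≥0∞) ^ (p + 1))⁻¹ else 0 := by
    intro l n
    rw [if_congr (antitone_snoc_iff n l (m + 1)) rfl rfl, Fin.prod_univ_castSucc, ite_and]
    simp only [Fin.snoc_castSucc, Fin.snoc_last, ite_mul, zero_mul]
  rw [zetaStarTail, ← (Fin.snocEquiv fun _ : Fin (d + 1) => ℕ).tsum_eq, ENNReal.tsum_prod']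
  refine (tsum_congr fun l => tsum_congr fun n => hterm l n).trans ?_
  rw [tsum_eq_zero_add' ENNReal.summable, tailStep]
  simp only [nonpos_iff_eq_zero, Nat.add_eq_zero_iff, one_ne_zero, and_false, if_false,
    tsum_zero, zero_add, add_le_add_iff_right]
  refine tsum_congr fun l => ?_
  split_ifs
  · rw [ENNReal.tsum_mul_right]
    have h := divStep_iterate (zetaStarTail k) (p + 1) l
    rw [Function.iterate_succ_apply', divStep] at h
    rw [h, zetaStarTail]
    push_cast
    rfl
  · exact tsum_zero

lemma zetaStarTail_succ {d : ℕ} (k : Fin (d + 1) → ℕ) (h : 1 ≤ k (Fin.last d)) :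
    zetaStarTail k = tailStep (divStep^[k (Fin.last d) - 1] (zetaStarTail (Fin.init k))) := by
  rw [← zetaStarTail_snoc, Nat.sub_add_cancel h, Fin.snoc_init_self]

/-- The sequences attached to nonempty words starting with `true`. -/
def IsWordSeq (a : ℕ → ℝ≥0∞) : Prop :=
  ∃ (ω : ℕ → Bool) (n : ℕ), ω 0 = true ∧ a = wordSeq 1 ω (n + 1)

lemma isWordSeq_divStep_one : IsWordSeq (divStep 1) := ⟨fun _ => true, 0, rfl, rfl⟩

lemma IsWordSeq.letterStep {a : ℕ → ℝ≥0∞} (h : IsWordSeq a) (b : Bool) :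
    IsWordSeq (letterStep b a) := by
  obtain ⟨ω, n, h0, rfl⟩ := h
  refine ⟨Function.update ω (n + 1) b, n + 1, by simpa using h0, ?_⟩
  rw [wordSeq.eq_2 _ _ (n + 1), Function.update_self]
  congr 1
  refine wordSeq_congr 1 fun j hj => ?_
  rw [Function.update_of_ne hj.ne]

lemma IsWordSeq.divStep_iterate {a : ℕ → ℝ≥0∞} (h : IsWordSeq a) (p : ℕ) :
    IsWordSeq (divStep^[p] a) := by
  induction p with
  | zero => exact h
  | succ p ih =>
    rw [Function.iterate_succ_apply']
    exact ih.letterStep true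

lemma exists_isWordSeq_of_zetaStarTail {d : ℕ} (k : Fin (d + 1) → ℕ) (h0 : 2 ≤ k 0)
    (h1 : ∀ j, 1 ≤ k j) : ∃ a, IsWordSeq a ∧ zetaStarTail k = tailStep a := by
  induction d with
  | zero =>
    refine ⟨divStep^[k 0 - 1] 1, ?_, ?_⟩
    -- Convergence, `2 ≤ k 0`, is what makes the word begin with `true`.
    · obtain ⟨q, hq⟩ : ∃ q, k 0 - 1 = q + 1 := ⟨k 0 - 2, by omega⟩
      rw [hq, Function.iterate_succ_apply]
      exact isWordSeq_divStep_one.divStep_iterate q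
    · rw [zetaStarTail_succ k (h1 _), zetaStarTail_zero]
      rfl
  | succ d ih =>
    obtain ⟨a, ha, hka⟩ := ih (Fin.init k) h0 (fun j => h1 _)
    refine ⟨divStep^[k (Fin.last (d + 1)) - 1] (tailStep a),
      (ha.letterStep false).divStep_iterate _, ?_⟩
    rw [← hka, ← zetaStarTail_succ k (h1 _)]

/-- Indices `(k_1, …, k_d)` of convergent multiple zeta-star values. -/
def IsAdmissible {d : ℕ} (k : Fin (d + 1) → ℕ) : Prop := 2 ≤ k 0 ∧ ∀ j, 1 ≤ k j

lemma IsAdmissible.snoc {d : ℕ} {k : Fin (d + 1) → ℕ} (h : IsAdmissible k) (p : ℕ) :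
    IsAdmissible (Fin.snoc k (p + 1) : Fin (d + 2) → ℕ) := by
  refine ⟨?_, fun j => ?_⟩
  · have : (0 : Fin (d + 2)) = (0 : Fin (d + 1)).castSucc := rfl
    rw [this, Fin.snoc_castSucc]
    exact h.1
  · induction j using Fin.lastCases with
    | last => simp
    | cast j => simpa using h.2 j

lemma isAdmissible_single (p : ℕ) (k : Fin 0 → ℕ) :
    IsAdmissible (Fin.snoc k (p + 1 + 1) : Fin 1 → ℕ) := by
  have h : ∀ j : Fin 1, (Fin.snoc k (p + 1 + 1) : Fin 1 → ℕ) j = p + 2 := fun j => by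
    rw [Subsingleton.elim j (Fin.last 0), Fin.snoc_last]
  exact ⟨by rw [h]; omega, fun j => by rw [h]; omega⟩

/-- Each block of `p` letters `true` closed by a `false` contributes the exponent p + 1; a trailing
block of `true` remains as pending divisions. -/
lemma wordSeq_eq_divStep_iterate {ω : ℕ → Bool} (h0 : ω 0 = true) (n : ℕ) :
    (∃ p, wordSeq 1 ω (n + 1) = divStep^[p + 1] 1) ∨
      ∃ (d : ℕ) (k : Fin (d + 1) → ℕ) (p : ℕ), IsAdmissible k ∧
        wordSeq 1 ω (n + 1) = divStep^[p] (zetaStarTail k) := by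
  induction n with
  | zero => exact Or.inl ⟨0, by simp [wordSeq, h0, letterStep]⟩
  | succ n ih =>
    rw [wordSeq]
    cases ω (n + 1)
    · right
      rcases ih with ⟨p, hp⟩ | ⟨d, k, p, hk, hp⟩
      · refine ⟨0, _, 0, isAdmissible_single p Fin.elim0, ?_⟩
        rw [zetaStarTail_snoc, zetaStarTail_zero, hp]
        rfl
      · refine ⟨d + 1, _, 0, hk.snoc p, ?_⟩
        rw [zetaStarTail_snoc, hp]
        rfl
    · rcases ih with ⟨p, hp⟩ | ⟨d, k, p, hk, hp⟩
      · refine Or.inl ⟨p + 1, ?_⟩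
        rw [Function.iterate_succ_apply', ← hp]
        rfl
      · refine Or.inr ⟨d, k, p + 1, hk, ?_⟩
        rw [Function.iterate_succ_apply', ← hp]
        rfl

lemma exists_zetaStarTail_eq {ω : ℕ → Bool} (h0 : ω 0 = true) (n : ℕ) :
    ∃ (d : ℕ) (k : Fin (d + 1) → ℕ), IsAdmissible k ∧
      tailStep (wordSeq 1 ω (n + 1)) = zetaStarTail k := by
  rcases wordSeq_eq_divStep_iterate h0 n with ⟨p, hp⟩ | ⟨d, k, p, hk, hp⟩
  · exact ⟨0, _, isAdmissible_single p Fin.elim0, by rw [zetaStarTail_snoc, zetaStarTail_zero, hp]⟩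
  · exact ⟨d + 1, _, hk.snoc p, by rw [zetaStarTail_snoc, hp]⟩

lemma mem_zetaStarValues_iff {z : ℝ} :
    z ∈ zetaStarValues ↔ ∃ (ω : ℕ → Bool) (n : ℕ), ω 0 = true ∧
      z = (tailStep (wordSeq 1 ω (n + 1)) 0).toReal := by
  constructor
  · rintro ⟨d, k, h0, h1, rfl⟩
    obtain ⟨_, ⟨ω, n, hω, rfl⟩, hk⟩ := exists_isWordSeq_of_zetaStarTail k h0 h1
    exact ⟨ω, n, hω, by rw [zetaStar_eq, hk]⟩
  · rintro ⟨ω, n, h0, rfl⟩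
    obtain ⟨d, k, hk, heq⟩ := exists_zetaStarTail_eq h0 n
    exact ⟨d, k, hk.1, hk.2, by rw [zetaStar_eq, heq]⟩

/-! ### Injectivity and image of ξ. -/

lemma xi_notMem_zetaStarValues {i : ℕ → ℕ} (hi : i ∈ alternatingSequences) :
    xi i ∉ zetaStarValues := by
  rw [mem_zetaStarValues_iff]
  rintro ⟨ω, n, h0, hz⟩
  have hreg := isReg_wordSeq h0 n
  have hv := (altIntegral_limit hi).2
  rw [hz, ENNReal.ofReal_toReal (hreg.tailStep.ne_top 0)] at hv
  -- The split point is interior to its own interval, so the word of `i` shares these n + 1 letters.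
  -- It is then a split point for `i` too, which the next interval of `i` excludes.
  have hω : Inside ω (n + 1) (tailStep (wordSeq 1 ω (n + 1)) 0) :=
    ⟨hreg.lt_tailStep_zero, hreg.tailStep_zero_lt⟩
  refine (hv (n + 2)).ne ?_
  rw [wordSeq_congr 1 ((hv (n + 1)).agree hω)]

lemma one_lt_xi {i : ℕ → ℕ} (hi : i ∈ alternatingSequences) : 1 < xi i := by
  have h := ((altIntegral_limit hi).2 0).1
  rwa [wordSeq, Pi.one_apply, ENNReal.one_lt_ofReal] at h

lemma injOn_xi : Set.InjOn xi alternatingSequences := by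
  intro i hi i' hi' heq
  refine runWord_injOn hi hi' (funext fun j => ?_)
  have h := (altIntegral_limit hi).2 (j + 1)
  rw [heq] at h
  exact h.agree ((altIntegral_limit hi').2 (j + 1)) j j.lt_succ_self

lemma exists_xi_eq {v : ℝ} (h1 : 1 < v) (hv : v ∉ zetaStarValues) :
    ∃ i ∈ alternatingSequences, xi i = v := by
  have hpos : 0 ≤ v := zero_le_one.trans h1.le
  have h0 := greedyWord_zero (v := ENNReal.ofReal v) ENNReal.ofReal_ne_top
  have hin : ∀ n, Inside (greedyWord (ENNReal.ofReal v)) n (ENNReal.ofReal v) := by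
    refine inside_greedyWord (ENNReal.one_lt_ofReal.2 h1) ENNReal.ofReal_ne_top fun n hn => hv ?_
    rw [mem_zetaStarValues_iff]
    exact ⟨_, n, h0, by rw [← hn, ENNReal.toReal_ofReal hpos]⟩
  have ht := Inside.frequently_true h0 hin
  have hf := Inside.frequently_false h0 hin
  obtain ⟨i, hi, hω⟩ := exists_runWord_eq h0 ht hf
  refine ⟨i, hi, ?_⟩
  have h := (altIntegral_limit hi).2
  rw [hω] at h
  have heq := Inside.unique h0 ht hf h hin
  rwa [ENNReal.ofReal_eq_ofReal_iff (zero_le_one.trans (one_lt_xi hi).le) hpos] at heq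

theorem theorem1p6 :
    (∀ i ∈ alternatingSequences,
      (∀ r : ℕ, 1 ≤ r →
        IntegrableOn (fun x => 1 / altDenom i r x) (Set.Icc (0 : Fin (i r) → ℝ) 1)) ∧
      Tendsto (altIntegral i) atTop (𝓝 (xi i)) ∧ 1 < xi i) ∧
    Set.InjOn xi alternatingSequences ∧
    xi '' alternatingSequences = Set.Ioi 1 \ zetaStarValues := by
  refine ⟨fun i hi => ⟨fun r hr => integrableOn_altDenom_of_pos hi hr, (altIntegral_limit hi).1,
    one_lt_xi hi⟩, injOn_xi, Set.Subset.antisymm ?_ ?_⟩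
  · rintro _ ⟨i, hi, rfl⟩
    exact ⟨one_lt_xi hi, xi_notMem_zetaStarValues hi⟩
  · rintro v ⟨h1, hv⟩
    exact exists_xi_eq h1 hv
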